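/- Let $\Delta P(t)=P(t+1)-P(t)$ be the forward difference operator on $\mathbb{C}[t]$. For $n\ge 0$ and polynomials $P,Q\in\mathbb{C}_n[t]$ (that is, of degree at most $n$), the umbral additive convolution of level $n$ is \[ (P\boxplus_n^{\Delta}Q)(z)=\frac{1}{n!}\sum_{k=0}^{n}(\Delta^kP)(0)\,(\Delta^{n-k}Q)(z). \] For $-\infty\le a\le b\le+\infty$ put $V(a,b)=\{z\in\mathbb{C} : a\le \operatorname{Re} z\le b\}$, and for a polynomial $P$ let $V(P)$ be the smallest strip $V(a,b)$ containing all complex roots of $P$ (so $V(P)=\emptyset$ if $P$ is a nonzero constant). **Umbral Walsh theorem.** Let $n\ge 0$. 1. If $P,Q\in\mathbb{C}_n[t]$ and $P\boxplus_n^{\Delta}Q\neq 0$, then \[ V(P\boxplus_n^{\Delta}Q)\subseteq V(P)+V(Q)-\frac{n-1}{2}. \] 2. If $P$ and $Q$ have degree exactly $n$, then $P\boxplus_n^{\Delta}Q$ has degree exactly $n$; in particular it is nonzero and 1 applies. 3. The constant $\frac{n-1}{2}$ is optimal for every $n\ge1$: for $P=Q=t^n$ the inclusion is an equality, \[ V(t^n\boxplus_n^{\Delta}t^n)=V(t^n)+V(t^n)-\frac{n-1}{2},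 \] and if $c\in\mathbb{R}$ is such that $V(P\boxplus_n^{\Delta}Q)\subseteq V(P)+V(Q)-c$ for all $P,Q$ of degree $n$, then $c=\frac{n-1}{2}$. -/

import Mathlib

open Polynomial
open scoped Pointwise

/-- The forward difference operator `Δ P (t) = P (t + 1) - P (t)` on complex polynomials. -/
noncomputable def forwardDelta : ℂ[X] →ₗ[ℂ] ℂ[X] where
  toFun P := P.comp (X + 1) - P
  map_add' P Q := by simp only [add_comp]; ring
  map_smul' c P := by simp [smul_comp, smul_sub]

/-- The umbral additive convolution of level `n` attached to an operator `𝔡`: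
`(A ⊞ B)(z) = (1 / n!) ∑_{k = 0}^{n} (𝔡 ^ k A)(0) · (𝔡 ^ (n - k) B)(z)`. -/
noncomputable def umbralConv (𝔡 : ℂ[X] →ₗ[ℂ] ℂ[X]) (n : ℕ) (A B : ℂ[X]) : ℂ[X] :=
  ((n.factorial : ℂ)⁻¹) •
    ∑ k ∈ Finset.range (n + 1), (((𝔡 ^ k) A).eval 0) • ((𝔡 ^ (n - k)) B)

/-- The closed vertical strip `{z | a ≤ Re z ≤ b}`, for `a, b ∈ [-∞, +∞]`. -/
def verticalStrip (a b : EReal) : Set ℂ :=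
  {z | a ≤ (z.re : EReal) ∧ (z.re : EReal) ≤ b}

/-- `V(P)`: the smallest strip `verticalStrip a b`, `-∞ ≤ a ≤ b ≤ +∞`, that contains all the
complex roots of `P` (see `isLeast_rootStrip`). It is empty if `P` is a nonzero constant, and
all of `ℂ` if `P = 0`. -/
def rootStrip (P : ℂ[X]) : Set ℂ :=
  ⋂₀ {S | ∃ a b : EReal, a ≤ b ∧ S = verticalStrip a b ∧ ∀ z : ℂ, P.eval z = 0 → z ∈ S}

/-- The smallest strip exists and is `rootStrip P`. -/
theorem isLeast_rootStrip (P : ℂ[X]) :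
    IsLeast {S | ∃ a b : EReal, a ≤ b ∧ S = verticalStrip a b ∧
      ∀ z : ℂ, P.eval z = 0 → z ∈ S} (rootStrip P) := by
  refine ⟨?_, fun S hS => Set.sInter_subset_of_mem hS⟩
  by_cases h : ∃ w : ℂ, P.eval w = 0
  · obtain ⟨w, hw⟩ := h
    set a : EReal := ⨅ z : {z : ℂ // P.eval z = 0}, ((z : ℂ).re : EReal) with ha
    set b : EReal := ⨆ z : {z : ℂ // P.eval z = 0}, ((z : ℂ).re : EReal) with hb
    have h1 : ∀ z : ℂ, P.eval z = 0 → z ∈ verticalStrip a b := fun z hz =>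
      ⟨iInf_le (fun z : {z : ℂ // P.eval z = 0} => ((z : ℂ).re : EReal)) ⟨z, hz⟩,
        le_iSup (fun z : {z : ℂ // P.eval z = 0} => ((z : ℂ).re : EReal)) ⟨z, hz⟩⟩
    have hab : a ≤ b := (h1 w hw).1.trans (h1 w hw).2
    refine ⟨a, b, hab, ?_, fun z hz => ?_⟩
    · apply Set.Subset.antisymm
      · exact Set.sInter_subset_of_mem ⟨a, b, hab, rfl, h1⟩
      · rintro z hz S ⟨c, d, -, rfl, hS⟩
        exact ⟨le_trans (le_iInf fun y : {z : ℂ // P.eval z = 0} => (hS y.1 y.2).1) hz.1,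
          le_trans hz.2 (iSup_le fun y : {z : ℂ // P.eval z = 0} => (hS y.1 y.2).2)⟩
    · rintro S ⟨c, d, -, rfl, hS⟩
      exact hS z hz
  · have h1 : ∀ z : ℂ, P.eval z = 0 → z ∈ verticalStrip ⊤ ⊤ := fun z hz => (h ⟨z, hz⟩).elim
    refine ⟨⊤, ⊤, le_rfl, ?_, fun z hz => (h ⟨z, hz⟩).elim⟩
    have h2 : verticalStrip ⊤ ⊤ = ∅ := by
      ext z
      simp [verticalStrip]
    rw [h2]
    apply Set.eq_empty_of_subset_empty
    rw [← h2]
    exact Set.sInter_subset_of_mem ⟨⊤, ⊤, le_rfl, rfl, h1⟩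

theorem forwardDelta_descPochhammer (n : ℕ) :
    forwardDelta (descPochhammer ℂ (n + 1)) = ((n : ℂ) + 1) • descPochhammer ℂ n := by
  have h1 : (descPochhammer ℂ (n + 1)).comp (X + 1) = (X + 1) * descPochhammer ℂ n := by
    rw [descPochhammer_succ_left, mul_comp, comp_assoc]
    simp
  show (descPochhammer ℂ (n + 1)).comp (X + 1) - descPochhammer ℂ (n + 1) = _
  rw [h1, descPochhammer_succ_right, smul_eq_C_mul]
  simp only [map_add, map_natCast, map_one]
  ring

theorem forwardDelta_pow_descPochhammer (n k : ℕ) :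
    (forwardDelta ^ k) (descPochhammer ℂ (n + k)) =
      (((n + k).factorial : ℂ) / n.factorial) • descPochhammer ℂ n := by
  induction k with
  | zero => simp [div_self, Nat.factorial_ne_zero]
  | succ k ih =>
    rw [pow_succ, Module.End.mul_apply, ← add_assoc, forwardDelta_descPochhammer, map_smul, ih,
      smul_smul, Nat.factorial_succ]
    push_cast
    congr 1
    ring

/-- The falling factorial of degree `n` is a unit for the convolution of level `n`
attached to `Δ`. -/
theorem umbralConv_descPochhammer (n : ℕ) (A : ℂ[X]) (hA : A.natDegree ≤ n) :
    umbralConv forwardDelta n A (descPochhammer ℂ n) = A := by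
  have key : umbralConv forwardDelta n A (descPochhammer ℂ n) =
      ∑ k ∈ Finset.range (n + 1),
        (((forwardDelta ^ k) A).eval 0 / (k.factorial : ℂ)) • descPochhammer ℂ k := by
    rw [umbralConv, Finset.smul_sum]
    refine Finset.sum_congr rfl fun k hk => ?_
    have hk' : k + (n - k) = n := by have := Finset.mem_range.1 hk; omega
    have h2 := forwardDelta_pow_descPochhammer k (n - k)
    rw [hk'] at h2
    rw [h2, smul_smul, smul_smul]
    congr 1
    have : (n.factorial : ℂ) ≠ 0 := by exact_mod_cast n.factorial_ne_zero
    field_simp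
  have hfd : ∀ (k : ℕ) (x : ℂ), ((forwardDelta ^ k) A).eval x =
      ((fwdDiff (1 : ℂ))^[k] (fun y => A.eval y)) x := by
    intro k
    induction k with
    | zero => intro x; simp
    | succ k ih =>
      intro x
      rw [pow_succ', Module.End.mul_apply, Function.iterate_succ_apply', fwdDiff, ← ih, ← ih]
      simp [forwardDelta]
  rw [key]
  apply Polynomial.eq_of_infinite_eval_eq
  refine Set.Infinite.mono (s := Set.range fun m : {m : ℕ // n ≤ m} => ((m : ℕ) : ℂ)) ?_ ?_
  · rintro _ ⟨⟨m, hm⟩, rfl⟩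
    have h3 := shift_eq_sum_fwdDiff_iter (1 : ℂ) (fun y => A.eval y) m 0
    simp only [zero_add, nsmul_eq_mul, mul_one] at h3
    simp only [Set.mem_ofPred_eq]
    rw [h3, eval_finsetSum]
    have hle : n + 1 ≤ m + 1 := by omega
    rw [← Finset.sum_subset (Finset.range_mono hle)]
    · refine Finset.sum_congr rfl fun k _ => ?_
      rw [eval_smul, ← hfd, descPochhammer_eval_eq_descFactorial, Nat.descFactorial_eq_factorial_mul_choose]
      have : (k.factorial : ℂ) ≠ 0 := by exact_mod_cast k.factorial_ne_zero
      simp only [smul_eq_mul]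
      push_cast
      field_simp
    · intro k _ hk
      have hk' : n < k := by
        have := mt Finset.mem_range.2 hk; omega
      have h0 : (fwdDiff (1 : ℂ))^[k] (fun y => A.eval y) = 0 :=
        Polynomial.fwdDiff_iter_eq_zero_of_degree_lt (lt_of_le_of_lt hA hk')
      rw [h0]; simp
  · have : Infinite {m : ℕ // n ≤ m} := (Set.Ici_infinite n).to_subtype
    exact Set.infinite_range_of_injective
      ((Nat.cast_injective (R := ℂ)).comp Subtype.val_injective)

/-- On `ℂ_n[t]`, the convolution attached to `Δ` is the product of translation invariant
operators, transported by `D ↦ D S_n`, where `S_n = t (t - 1) ⋯ (t - n + 1)`. -/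
theorem umbralConv_transport (n : ℕ) (D₁ D₂ : ℂ[X] →ₗ[ℂ] ℂ[X])
    (h₁ : (D₁ (descPochhammer ℂ n)).natDegree ≤ n)
    (h₂ : ∀ (c : ℂ) (P : ℂ[X]), D₂ (P.comp (X + C c)) = (D₂ P).comp (X + C c)) :
    umbralConv forwardDelta n (D₁ (descPochhammer ℂ n)) (D₂ (descPochhammer ℂ n)) =
      D₂ (D₁ (descPochhammer ℂ n)) := by
  have hc : ∀ P, forwardDelta (D₂ P) = D₂ (forwardDelta P) := by
    intro P
    have := h₂ 1 P
    rw [C_1] at this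
    simp [forwardDelta, this]
  have hck : ∀ (k : ℕ) (P), (forwardDelta ^ k) (D₂ P) = D₂ ((forwardDelta ^ k) P) := by
    intro k
    induction k with
    | zero => intro P; simp
    | succ k ih => intro P; simp only [pow_succ', Module.End.mul_apply, ih, hc]
  conv_rhs => rw [← umbralConv_descPochhammer n _ h₁]
  simp only [umbralConv, map_smul, map_sum, hck]

/-! The roots of `P` are peeled off one by one, as in Walsh's theorem. For `P = (t - α) R`, the
value at `z` of the convolution of level `n + 1` is, up to a nonzero constant, that of level `n` for
`R` and a polar derivative of `Q` whose pole depends on `z` (`umbralConv_X_sub_C_mul`). If `z` lies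
outside the expected half-plane, a discrete Laguerre theorem (`polarDelta_root_bound`) puts the
roots of this polar derivative in the half-plane of `Q` moved left by `1 / 2`. One such shift per
level, starting from level 1, gives `(n - 1) / 2`.

Laguerre's theorem rests on `exists_prod_ratio`: each factor of `Q (s + 1) / Q s` has the form `(v +
1/2) / (v - 1/2)`, and a product of `m` of them is `(y + m/2) / (y - m/2)` with `y` in the same
half-plane as the `v`. The equation for a root of the polar derivative then determines `y`, and the
position of the pole contradicts its real part.

The sign `ε` treats upper and lower bounds on real parts together. For `t ^ n` the two bounds
coincide, whence optimality. -/

/-! ### Products of ratios with parameters in a half-plane -/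

/-- A weighted harmonic mean of points of the half-plane `h ≤ Re` stays there, even after adding a
term with positive real part. -/
theorem le_re_harmonic_combination {h : ℝ} (hh : 0 < h) {p q : ℝ} (hp : 0 < p) (hq : 0 < q)
    {v w : ℂ} (hv : h ≤ v.re) (hw : h ≤ w.re) :
    h ≤ (((p : ℂ) + q) * (v * w + p * q / 4) / (q * v + p * w)).re := by
  set D : ℂ := q * v + p * w with hD
  have hDre : 0 < D.re := by
    simp only [hD, Complex.add_re, Complex.mul_re, Complex.ofReal_re, Complex.ofReal_im, zero_mul,
      sub_zero]
    have := mul_pos hq (hh.trans_le hv)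
    have := mul_pos hp (hh.trans_le hw)
    linarith
  have hD0 : D ≠ 0 := fun h0 => by simp [h0] at hDre
  have hns : 0 < Complex.normSq D := Complex.normSq_pos.2 hD0
  rw [Complex.div_re, ← add_div, le_div_iff₀ hns]
  have ha : 0 ≤ v.re - h := sub_nonneg.2 hv
  have hb : 0 ≤ w.re - h := sub_nonneg.2 hw
  -- `h1` comes from the summand `p * q / 4`; the rest, expanded in `v.re - h` and `w.re - h`, is
  -- grouped by powers of `h`, the cubic terms cancelling.
  have h1 : 0 ≤ (p + q) * p * q / 4 * D.re := by positivity
  have h2 : 0 ≤ h ^ 2 * (p + q) * (p * (v.re - h) + q * (w.re - h)) := by positivity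
  have h3 : 0 ≤ h * (p * q * ((v.re - h) ^ 2 + (w.re - h) ^ 2 + (v.im - w.im) ^ 2) +
      2 * (p ^ 2 + q ^ 2 + p * q) * ((v.re - h) * (w.re - h))) := by positivity
  have h4 : 0 ≤ (p + q) * (q * ((v.re - h) ^ 2 + v.im ^ 2) * (w.re - h) +
      p * ((w.re - h) ^ 2 + w.im ^ 2) * (v.re - h)) := by positivity
  refine le_of_sub_nonneg ((add_nonneg (add_nonneg h1 h2) (add_nonneg h3 h4)).trans_eq ?_)
  simp only [hD, Complex.normSq_apply, Complex.add_re, Complex.add_im, Complex.mul_re,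
    Complex.mul_im, Complex.ofReal_re, Complex.ofReal_im, Complex.div_ofNat_re,
    Complex.div_ofNat_im]
  ring

/-- `(v, m) ↦ (v + m / 2) / (v - m / 2)` combines multiplicatively, staying in a half-plane. -/
theorem exists_combine {ε h : ℝ} (hε : ε = 1 ∨ ε = -1) (hh : 0 < h) {p q : ℝ} (hp : 0 < p)
    (hq : 0 < q) {v w : ℂ} (hv : h ≤ ε * v.re) (hw : h ≤ ε * w.re) :
    ∃ y : ℂ, h ≤ ε * y.re ∧
      (v + p / 2) * (w + q / 2) * (y - (p + q) / 2) =
        (v - p / 2) * (w - q / 2) * (y + (p + q) / 2) := by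
  have hv' : h ≤ ((ε : ℂ) * v).re := by simpa using hv
  have hw' : h ≤ ((ε : ℂ) * w).re := by simpa using hw
  have hεε : (ε : ℂ) * ε = 1 := by rcases hε with rfl | rfl <;> simp
  have hε0 : (ε : ℂ) ≠ 0 := left_ne_zero_of_mul_eq_one hεε
  have hD0 : (q : ℂ) * v + p * w ≠ 0 := by
    intro h0
    have h1 : ((ε : ℂ) * (q * v + p * w)).re = q * (ε * v.re) + p * (ε * w.re) := by
      simp; ring
    rw [h0] at h1
    have := mul_pos hq (hh.trans_le hv)
    have := mul_pos hp (hh.trans_le hw)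
    simp at h1
    linarith
  refine ⟨((p : ℂ) + q) * (v * w + p * q / 4) / (q * v + p * w), ?_, ?_⟩
  · have key := le_re_harmonic_combination hh hp hq hv' hw'
    convert key using 1
    rw [← Complex.re_ofReal_mul]
    congr 1
    have h3 : (q : ℂ) * (ε * v) + p * (ε * w) = ε * (q * v + p * w) := by ring
    have h4 : ((ε : ℂ) * v) * (ε * w) = v * w := by linear_combination v * w * hεε
    rw [h3, h4]
    rw [← mul_div_assoc, div_eq_div_iff hD0 (mul_ne_zero hε0 hD0)]
    linear_combination
      (((p : ℂ) + q) * (v * w + p * q / 4)) * (q * v + p * w) * hεε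
  · have hy := div_mul_cancel₀ (((p : ℂ) + q) * (v * w + p * q / 4)) hD0
    linear_combination hy

/-- The cross-multiplied form allows vanishing denominators, such as `v = 1 / 2`. -/
theorem exists_prod_ratio {ε h : ℝ} (hε : ε = 1 ∨ ε = -1) (hh : 0 < h) (s : Multiset ℂ)
    (hs : s ≠ 0) (hv : ∀ v ∈ s, h ≤ ε * v.re) :
    ∃ y : ℂ, h ≤ ε * y.re ∧
      (s.map (· + 1 / 2)).prod * (y - s.card / 2) =
        (s.map (· - 1 / 2)).prod * (y + s.card / 2) := by
  induction s using Multiset.induction_on with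
  | empty => exact (hs rfl).elim
  | cons v s ih =>
    have hv1 := hv v (Multiset.mem_cons_self v s)
    by_cases h0 : s = 0
    · subst h0
      refine ⟨v, hv1, ?_⟩
      simp; ring
    · obtain ⟨w, hw, hprod⟩ := ih h0 fun u hu => hv u (Multiset.mem_cons_of_mem hu)
      have hc : (0 : ℝ) < s.card := by exact_mod_cast Multiset.card_pos.2 h0
      obtain ⟨y, hy, hy2⟩ := exists_combine hε hh one_pos hc hv1 hw
      refine ⟨y, hy, ?_⟩
      -- Chaining the two cross-multiplied identities requires cancelling one of these factors; both
      -- vanish only if `w = 0`, which `h > 0` excludes.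
      have hwne : (w + s.card / 2 ≠ 0) ∨ (w - s.card / 2 ≠ 0) := by
        by_contra! hcon
        have h2 : w = 0 := by linear_combination (hcon.1 + hcon.2) / 2
        rw [h2] at hw
        simp at hw
        linarith
      simp only [Multiset.map_cons, Multiset.prod_cons, Multiset.card_cons]
      push_cast at hy2 ⊢
      rcases hwne with hne | hne
      · refine mul_left_cancel₀ hne ?_
        linear_combination (s.map (· + 1 / 2)).prod * hy2 +
          (v - 1 / 2) * (y + (1 + s.card) / 2) * hprod
      · refine mul_left_cancel₀ hne ?_
        linear_combination (s.map (· - 1 / 2)).prod * hy2 +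
          (v + 1 / 2) * (y - (1 + s.card) / 2) * hprod
-- Degrees, the Leibniz rule and recursions for the convolution
theorem forwardDelta_eval (P : ℂ[X]) (z : ℂ) :
    (forwardDelta P).eval z = P.eval (z + 1) - P.eval z := by
  simp [forwardDelta]

theorem forwardDelta_eq_taylor (P : ℂ[X]) : forwardDelta P = taylor 1 P - P := by
  simp [forwardDelta, taylor_apply]

theorem natDegree_forwardDelta_le {P : ℂ[X]} {n : ℕ} (hP : P.natDegree ≤ n + 1) :
    (forwardDelta P).natDegree ≤ n := by
  rw [natDegree_le_iff_coeff_eq_zero]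
  intro N hN
  rw [forwardDelta_eq_taylor, coeff_sub]
  rcases (Nat.succ_le_of_lt hN).eq_or_lt with h | h
  · rcases hP.eq_or_lt with h2 | h2
    · have h3 : P.natDegree = N := h2.trans h
      have := coeff_taylor_natDegree (f := P) (r := 1)
      rw [h3] at this
      rw [this, leadingCoeff, h3, sub_self]
    · rw [coeff_eq_zero_of_natDegree_lt, coeff_eq_zero_of_natDegree_lt, sub_self]
      · omega
      · rw [natDegree_taylor]; omega
  · rw [coeff_eq_zero_of_natDegree_lt, coeff_eq_zero_of_natDegree_lt, sub_self]
    · omega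
    · rw [natDegree_taylor]; omega

theorem coeff_forwardDelta {P : ℂ[X]} {n : ℕ} (hP : P.natDegree ≤ n + 1) :
    (forwardDelta P).coeff n = (n + 1) * P.coeff (n + 1) := by
  rw [forwardDelta_eq_taylor, coeff_sub, taylor_coeff, hasseDeriv_apply,
    sum_over_range' _ _ (n + 2) (by omega), Finset.sum_range_succ, Finset.sum_range_succ,
    Finset.sum_eq_zero]
  · simp
  · intro k hk
    simp [Nat.choose_eq_zero_of_lt (Finset.mem_range.1 hk)]
  · simp

theorem natDegree_forwardDelta_pow_le {P : ℂ[X]} {n k : ℕ} (hP : P.natDegree ≤ n + k) :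
    ((forwardDelta ^ k) P).natDegree ≤ n := by
  induction k generalizing n with
  | zero => simpa using hP
  | succ k ih =>
    rw [pow_succ', Module.End.mul_apply]
    exact natDegree_forwardDelta_le (ih (by omega))

theorem coeff_forwardDelta_pow {P : ℂ[X]} {n k : ℕ} (hP : P.natDegree ≤ n + k) :
    ((forwardDelta ^ k) P).coeff n = (n + k).factorial / n.factorial * P.coeff (n + k) := by
  induction k generalizing n with
  | zero => simp [div_self, Nat.factorial_ne_zero]
  | succ k ih =>
    rw [pow_succ', Module.End.mul_apply,
      coeff_forwardDelta (natDegree_forwardDelta_pow_le (by omega)), ih (by omega),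
      Nat.factorial_succ n, show n + 1 + k = n + (k + 1) by ring]
    have : (n.factorial : ℂ) ≠ 0 := by exact_mod_cast n.factorial_ne_zero
    have : (n : ℂ) + 1 ≠ 0 := by exact_mod_cast n.succ_ne_zero
    push_cast
    field_simp

theorem forwardDelta_pow_eq_zero {P : ℂ[X]} {k : ℕ} (hP : P.natDegree < k) :
    (forwardDelta ^ k) P = 0 := by
  obtain ⟨k, rfl⟩ := Nat.exists_eq_succ_of_ne_zero (by omega : k ≠ 0)
  have h0 : ((forwardDelta ^ k) P).natDegree ≤ 0 := natDegree_forwardDelta_pow_le (by omega)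
  rw [Nat.succ_eq_add_one, pow_succ', Module.End.mul_apply, eq_C_of_natDegree_le_zero h0]
  simp [forwardDelta]

/-- The commutator of `Δ` with multiplication by `X - C β` is `1 + Δ`, which commutes with `Δ`. -/
theorem forwardDelta_pow_X_sub_C_mul (β : ℂ) (R : ℂ[X]) (k : ℕ) :
    (forwardDelta ^ (k + 1)) ((X - C β) * R) = (X - C β) * (forwardDelta ^ (k + 1)) R +
      ((k : ℂ) + 1) • ((forwardDelta ^ k) R + (forwardDelta ^ (k + 1)) R) := by
  have h1 : ∀ R : ℂ[X], forwardDelta ((X - C β) * R) =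
      (X - C β) * forwardDelta R + (R + forwardDelta R) := by
    intro R
    simp only [forwardDelta, LinearMap.coe_mk, AddHom.coe_mk, mul_comp, sub_comp, X_comp, C_comp]
    ring
  induction k with
  | zero => simp [h1]
  | succ k ih =>
    have hs : ∀ (j : ℕ) (R : ℂ[X]),
        forwardDelta ((forwardDelta ^ j) R) = (forwardDelta ^ (j + 1)) R := fun j R => by
      rw [pow_succ', Module.End.mul_apply]
    rw [← hs (k + 1), ih, map_add, map_smul, h1, map_add, hs, hs]
    push_cast
    module

theorem umbralConv_eval (n : ℕ) (P Q : ℂ[X]) (z : ℂ) :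
    (umbralConv forwardDelta n P Q).eval z = (n.factorial : ℂ)⁻¹ *
      ∑ k ∈ Finset.range (n + 1),
        ((forwardDelta ^ k) P).eval 0 * ((forwardDelta ^ (n - k)) Q).eval z := by
  simp [umbralConv, eval_finsetSum]

/-- When the degree of `P` drops, `ΔQ` takes the role of the polar derivative, as if the pole were
at infinity. -/
theorem umbralConv_of_natDegree_le {n : ℕ} {P : ℂ[X]} (hP : P.natDegree ≤ n) (Q : ℂ[X]) :
    umbralConv forwardDelta (n + 1) P Q =
      ((n : ℂ) + 1)⁻¹ • umbralConv forwardDelta n P (forwardDelta Q) := by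
  rw [umbralConv, umbralConv, Finset.sum_range_succ,
    forwardDelta_pow_eq_zero (Nat.lt_succ_of_le hP), eval_zero, zero_smul, add_zero, smul_smul,
    Nat.factorial_succ]
  push_cast
  rw [mul_inv]
  congr 1
  refine Finset.sum_congr rfl fun k hk => ?_
  rw [Nat.succ_sub (Finset.mem_range_succ_iff.1 hk), pow_succ, Module.End.mul_apply]

/-- The analogue for `Δ` of the polar derivative of `Q` at level `n` with pole `ζ`. -/
noncomputable def polarDelta (n : ℕ) (ζ : ℂ) (Q : ℂ[X]) : ℂ[X] :=
  (n : ℂ) • Q - (X - C ζ) * forwardDelta Q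

theorem natDegree_polarDelta_le {n : ℕ} {Q : ℂ[X]} (hQ : Q.natDegree ≤ n + 1) (ζ : ℂ) :
    (polarDelta (n + 1) ζ Q).natDegree ≤ n := by
  have hD := natDegree_forwardDelta_le hQ
  rw [natDegree_le_iff_coeff_eq_zero]
  intro N hN
  obtain ⟨N, rfl⟩ := Nat.exists_eq_succ_of_ne_zero (by omega : N ≠ 0)
  simp only [polarDelta, Nat.succ_eq_add_one, coeff_sub, sub_mul, coeff_X_mul, coeff_C_mul,
    coeff_smul, smul_eq_mul]
  rw [coeff_eq_zero_of_natDegree_lt (p := forwardDelta Q) (n := N + 1) (by omega)]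
  rcases (Nat.le_of_lt_succ hN).eq_or_lt with rfl | h
  · rw [coeff_forwardDelta hQ]
    push_cast
    ring
  · rw [coeff_eq_zero_of_natDegree_lt (p := Q) (by omega),
      coeff_eq_zero_of_natDegree_lt (p := forwardDelta Q) (by omega)]
    ring

/-- The Leibniz rule is applied to both sides. The pole `z + n - α` is the one for which the
coefficient of `Δ^(n + 1 - k) Q (z)` becomes `k - α`, matching what `(X - C α) * P` produces at `0`.
-/
theorem umbralConv_X_sub_C_mul {n : ℕ} {P : ℂ[X]} (hP : P.natDegree ≤ n) (α : ℂ) (Q : ℂ[X])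
    (z : ℂ) :
    (umbralConv forwardDelta (n + 1) ((X - C α) * P) Q).eval z =
      ((n : ℂ) + 1)⁻¹ *
        (umbralConv forwardDelta n P (polarDelta (n + 1) (z + n - α) Q)).eval z := by
  rw [umbralConv_eval, umbralConv_eval, Nat.factorial_succ]
  push_cast
  rw [mul_inv, mul_assoc]
  congr 2
  have hR : ∀ k ≤ n, ((forwardDelta ^ (n - k)) (polarDelta (n + 1) (z + n - α) Q)).eval z =
      (k + 1) * ((forwardDelta ^ (n - k)) Q).eval z +
        (k - α) * ((forwardDelta ^ (n + 1 - k)) Q).eval z := by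
    intro k hk
    obtain ⟨m, rfl⟩ := Nat.exists_eq_add_of_le hk
    rw [show k + m - k = m by omega, show k + m + 1 - k = m + 1 by omega, polarDelta, map_sub,
      map_smul]
    rcases m with _ | m
    · simp
      ring
    · rw [forwardDelta_pow_X_sub_C_mul, pow_succ _ (m + 1), Module.End.mul_apply]
      simp only [← Module.End.mul_apply, ← pow_succ]
      simp
      ring
  have hsum : ∀ k ∈ Finset.range (n + 1),
      ((forwardDelta ^ k) P).eval 0 *
        ((forwardDelta ^ (n - k)) (polarDelta (n + 1) (z + n - α) Q)).eval z =
      (k + 1) * ((forwardDelta ^ k) P).eval 0 * ((forwardDelta ^ (n - k)) Q).eval z +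
        (k - α) * ((forwardDelta ^ k) P).eval 0 * ((forwardDelta ^ (n + 1 - k)) Q).eval z := by
    intro k hk
    rw [hR k (Finset.mem_range_succ_iff.1 hk)]
    ring
  rw [Finset.sum_congr rfl hsum, Finset.sum_add_distrib, Finset.sum_range_succ']
  have hP0 : ((forwardDelta ^ (n + 1)) P).eval 0 = 0 := by
    rw [forwardDelta_pow_eq_zero (Nat.lt_succ_of_le hP), eval_zero]
  have hsplit : ∑ k ∈ Finset.range (n + 1),
      ((k : ℂ) - α) * ((forwardDelta ^ k) P).eval 0 * ((forwardDelta ^ (n + 1 - k)) Q).eval z =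
      ∑ k ∈ Finset.range (n + 1), (((k + 1 : ℕ) : ℂ) - α) *
        ((forwardDelta ^ (k + 1)) P).eval 0 * ((forwardDelta ^ (n - k)) Q).eval z +
      (-α) * P.eval 0 * ((forwardDelta ^ (n + 1)) Q).eval z := by
    have h1 := Finset.sum_range_succ (fun k : ℕ => ((k : ℂ) - α) *
      ((forwardDelta ^ k) P).eval 0 * ((forwardDelta ^ (n + 1 - k)) Q).eval z) (n + 1)
    rw [hP0, mul_zero, zero_mul, add_zero] at h1
    rw [← h1, Finset.sum_range_succ']
    simp
  rw [hsplit, ← add_assoc, ← Finset.sum_add_distrib]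
  congr 1
  · refine Finset.sum_congr rfl fun k _ => ?_
    rw [forwardDelta_pow_X_sub_C_mul, Nat.add_sub_add_right]
    simp
    ring
  · simp
-- Discrete Gauss–Lucas and Laguerre theorems
/-- If the roots of `Q` lie in a half-plane, then off the half-plane shifted by `1 / 2` the ratio
`Q (s + 1) / Q s` is that of a single point of the half-plane. -/
theorem exists_ratio_of_roots {ε d : ℝ} (hε : ε = 1 ∨ ε = -1) {Q : ℂ[X]} (hQ : Q.natDegree ≠ 0)
    (hroots : ∀ γ, Q.eval γ = 0 → ε * γ.re ≤ d) {s : ℂ} (hs : d < ε * (s.re + 1 / 2)) :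
    ∃ y : ℂ, ε * (s.re + 1 / 2) - d ≤ ε * y.re ∧
      Q.eval (s + 1) * (y - Q.natDegree / 2) = Q.eval s * (y + Q.natDegree / 2) := by
  have hQ0 : Q ≠ 0 := by rintro rfl; simp at hQ
  have hsplit := IsAlgClosed.splits Q
  have hcard : Q.roots.card = Q.natDegree := hsplit.natDegree_eq_card_roots.symm
  obtain ⟨y, hy, hprod⟩ := exists_prod_ratio hε (sub_pos.2 hs)
    (Q.roots.map fun γ => s - γ + 1 / 2)
    (by rw [← Multiset.card_pos, Multiset.card_map]; omega)
    (by
      intro v hv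
      obtain ⟨γ, hγ, rfl⟩ := Multiset.mem_map.1 hv
      have := hroots γ ((mem_roots hQ0).1 hγ)
      simp
      linarith)
  refine ⟨y, hy, ?_⟩
  have heval : ∀ x, Q.eval x = Q.leadingCoeff * (Q.roots.map fun γ => x - γ).prod := fun x => by
    conv_lhs => rw [hsplit.eq_prod_roots]
    simp [eval_multiset_prod, Multiset.map_map]
  rw [heval, heval]
  simp only [Multiset.map_map, Multiset.card_map, hcard, Function.comp_def] at hprod
  have h1 : ∀ γ : ℂ, s - γ + 1 / 2 + 1 / 2 = s + 1 - γ := fun γ => by ring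
  have h2 : ∀ γ : ℂ, s - γ + 1 / 2 - 1 / 2 = s - γ := fun γ => by ring
  simp only [h1, h2] at hprod
  linear_combination Q.leadingCoeff * hprod

/-- This is Gauss–Lucas for `Δ`: equal values force `Q s = 0` through the ratio formula, so `s` and
`s + 1` are both roots, yet their midpoint lies outside the half-plane. -/
theorem eval_add_one_ne {ε d : ℝ} (hε : ε = 1 ∨ ε = -1) {Q : ℂ[X]} (hQ : Q.natDegree ≠ 0)
    (hroots : ∀ γ, Q.eval γ = 0 → ε * γ.re ≤ d) {s : ℂ} (hs : d < ε * (s.re + 1 / 2)) :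
    Q.eval (s + 1) ≠ Q.eval s := by
  obtain ⟨y, hy, h⟩ := exists_ratio_of_roots hε hQ hroots hs
  intro heq
  have hn : (Q.natDegree : ℂ) ≠ 0 := by exact_mod_cast hQ
  have hzero : Q.eval s = 0 := by
    refine (mul_eq_zero.1 (?_ : (Q.natDegree : ℂ) * Q.eval s = 0)).resolve_left hn
    rw [heq] at h
    linear_combination -h
  have h1 := hroots s hzero
  have h2 := hroots (s + 1) (heq.trans hzero)
  rcases hε with rfl | rfl <;> simp at h1 h2 hs <;> linarith

/-- Laguerre's theorem for the forward difference operator. -/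
theorem polarDelta_root_bound {ε d : ℝ} (hε : ε = 1 ∨ ε = -1) {n : ℕ} (hn : n ≠ 0) {Q : ℂ[X]}
    (hQ0 : Q ≠ 0) (hQ : Q.natDegree ≤ n) (hroots : ∀ γ, Q.eval γ = 0 → ε * γ.re ≤ d) {ζ : ℂ}
    (hζ : d < ε * (ζ.re - (n - 1) / 2)) {s : ℂ} (hs : (polarDelta n ζ Q).eval s = 0) :
    ε * (s.re + 1 / 2) ≤ d := by
  by_contra! hlt
  have hnC : (n : ℂ) ≠ 0 := by exact_mod_cast hn
  have hR : n * Q.eval s = (s - ζ) * (Q.eval (s + 1) - Q.eval s) := by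
    simp [polarDelta, forwardDelta_eval] at hs
    linear_combination hs
  by_cases hm : Q.natDegree = 0
  · obtain ⟨c, rfl⟩ := natDegree_eq_zero.1 hm
    simp [hn] at hR
    exact hQ0 (by rw [hR, C_0])
  obtain ⟨y, hy, h⟩ := exists_ratio_of_roots hε hm hroots hlt
  have hne := sub_ne_zero.2 (eval_add_one_ne hε hm hroots hlt)
  have hmC : (Q.natDegree : ℂ) ≠ 0 := by exact_mod_cast hm
  -- Eliminating `Q s` leaves a multiple of `Q (s + 1) - Q s`, which is nonzero and cancels.
  have hy2 : (n : ℂ) * y = Q.natDegree * (s - ζ + n / 2) := by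
    refine mul_right_cancel₀ hne ?_
    linear_combination (n : ℂ) * h + (Q.natDegree : ℂ) * hR
  have hre := congrArg Complex.re hy2
  simp at hre
  have hmR : (0 : ℝ) < Q.natDegree := by exact_mod_cast Nat.pos_of_ne_zero hm
  have hmn : (Q.natDegree : ℝ) ≤ n := by exact_mod_cast hQ
  have h3 : (n : ℝ) * (ε * y.re) = Q.natDegree * (ε * (s.re - ζ.re + n / 2)) := by
    linear_combination ε * hre
  have h4 : (Q.natDegree : ℝ) * (ε * (s.re + 1 / 2) - d) ≤ n * (ε * y.re) :=
    mul_le_mul hmn hy (sub_pos.2 hlt).le (by positivity)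
  rw [h3] at h4
  have h5 := le_of_mul_le_mul_left h4 hmR
  linarith

/-! ### Nonvanishing outside a half-plane, and the degree -/

theorem umbralConv_eval_ne_zero {ε : ℝ} (hε : ε = 1 ∨ ε = -1) {n : ℕ} :
    ∀ {b d : ℝ} {P Q : ℂ[X]}, P.degree = n → Q ≠ 0 → Q.natDegree ≤ n →
      (∀ γ, P.eval γ = 0 → ε * γ.re ≤ b) → (∀ γ, Q.eval γ = 0 → ε * γ.re ≤ d) →
      ∀ {z : ℂ}, b + d < ε * (z.re + (n - 1) / 2) →
      (umbralConv forwardDelta n P Q).eval z ≠ 0 := by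
  induction n with
  | zero =>
    intro b d P Q hP hQ0 hQ _ _ z _
    have hP' := eq_C_of_degree_eq_zero hP
    rw [eq_C_of_natDegree_le_zero hQ, hP']
    have h1 : P.coeff 0 ≠ 0 := by
      intro h; rw [h] at hP'; rw [hP'] at hP; simp at hP
    have h2 : Q.coeff 0 ≠ 0 := by
      intro h; apply hQ0; rw [eq_C_of_natDegree_le_zero hQ, h, C_0]
    simp [umbralConv_eval, h1, h2]
  | succ n ih =>
    intro b d P Q hP hQ0 hQ hPr hQr z hz
    obtain ⟨α, hα⟩ := Complex.exists_root (f := P) (by rw [hP]; exact_mod_cast n.succ_pos)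
    obtain ⟨P, rfl⟩ := dvd_iff_isRoot.2 hα
    have hP1 : P.degree = n := by
      rw [degree_mul, degree_X_sub_C, add_comm] at hP
      push_cast at hP
      exact WithBot.add_right_cancel (by simp) hP
    rw [umbralConv_X_sub_C_mul (natDegree_eq_of_degree_eq_some hP1).le]
    have hn : (n : ℂ) + 1 ≠ 0 := by exact_mod_cast n.succ_ne_zero
    refine mul_ne_zero (inv_ne_zero hn) ?_
    have hαb := hPr α hα
    push_cast at hz
    have hbound : ∀ s, (polarDelta (n + 1) (z + n - α) Q).eval s = 0 →
        ε * (s.re + 1 / 2) ≤ d := fun s hs => by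
      refine polarDelta_root_bound hε n.succ_ne_zero hQ0 hQ hQr ?_ hs
      simp
      linarith
    refine ih (b := b) (d := d - ε / 2) hP1 ?_ (natDegree_polarDelta_le hQ _)
      (fun γ hγ => hPr γ (by simp [hγ])) (fun γ hγ => ?_) ?_
    · intro h0
      -- A point with `ε * (s.re + 1 / 2) = d + 1`, which would be a root of the zero polynomial.
      have h1 := hbound ((ε * (d + 1) - 1 / 2 : ℝ) : ℂ) (by rw [h0, eval_zero])
      rw [Complex.ofReal_re] at h1
      rcases hε with rfl | rfl <;> linarith
    · have := hbound γ hγ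
      linarith
    · linarith

theorem umbralConv_eval_ne_zero_of_ne_zero {ε : ℝ} (hε : ε = 1 ∨ ε = -1) {n : ℕ} :
    ∀ {b d : ℝ} {P Q : ℂ[X]}, P.natDegree ≤ n → Q.natDegree ≤ n →
      umbralConv forwardDelta n P Q ≠ 0 →
      (∀ γ, P.eval γ = 0 → ε * γ.re ≤ b) → (∀ γ, Q.eval γ = 0 → ε * γ.re ≤ d) →
      ∀ {z : ℂ}, b + d < ε * (z.re + (n - 1) / 2) →
      (umbralConv forwardDelta n P Q).eval z ≠ 0 := by
  induction n with
  | zero =>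
    intro b d P Q hP hQ hne hPr hQr z hz
    have hP0 : P ≠ 0 := by rintro rfl; simp [umbralConv] at hne
    have hQ0 : Q ≠ 0 := by rintro rfl; simp [umbralConv] at hne
    refine umbralConv_eval_ne_zero hε ?_ hQ0 hQ hPr hQr hz
    rw [degree_eq_natDegree hP0, Nat.le_zero.1 hP]
  | succ n ih =>
    intro b d P Q hP hQ hne hPr hQr z hz
    have hP0 : P ≠ 0 := by rintro rfl; simp [umbralConv] at hne
    have hQ0 : Q ≠ 0 := by rintro rfl; simp [umbralConv] at hne
    rcases hP.eq_or_lt with h | h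
    · exact umbralConv_eval_ne_zero hε (by rw [degree_eq_natDegree hP0, h]) hQ0 hQ hPr hQr hz
    have hPn := Nat.le_of_lt_succ h
    rw [umbralConv_of_natDegree_le hPn] at hne ⊢
    have hne' := right_ne_zero_of_smul hne
    rw [eval_smul, smul_eq_mul]
    refine mul_ne_zero (left_ne_zero_of_smul hne) ?_
    have hm : Q.natDegree ≠ 0 := by
      intro h0
      rw [eq_C_of_natDegree_eq_zero h0] at hne'
      simp [umbralConv, forwardDelta] at hne'
    push_cast at hz
    refine ih (b := b) (d := d - ε / 2) hPn (natDegree_forwardDelta_le hQ) hne' hPr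
      (fun γ hγ => ?_) (by linarith)
    by_contra! hlt
    rw [forwardDelta_eval, sub_eq_zero] at hγ
    exact eval_add_one_ne hε hm hQr (by linarith) hγ

theorem degree_umbralConv {n : ℕ} {P Q : ℂ[X]} (hP : P.degree = n) (hQ : Q.degree = n) :
    (umbralConv forwardDelta n P Q).degree = n := by
  have hPn := natDegree_eq_of_degree_eq_some hP
  have hQn := natDegree_eq_of_degree_eq_some hQ
  have hPc : P.coeff n ≠ 0 := coeff_ne_zero_of_eq_degree hP
  have hQc : Q.coeff n ≠ 0 := coeff_ne_zero_of_eq_degree hQ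
  refine degree_eq_of_le_of_coeff_ne_zero ?_ ?_
  · rw [umbralConv]
    refine (degree_smul_le _ _).trans (degree_le_of_natDegree_le (natDegree_sum_le_of_forall_le _ _
      fun k _ => (natDegree_smul_le _ _).trans (natDegree_forwardDelta_pow_le (by omega))))
  · have hf : (n.factorial : ℂ) ≠ 0 := by exact_mod_cast n.factorial_ne_zero
    rw [umbralConv, coeff_smul, finsetSum_coeff, Finset.sum_range_succ, Finset.sum_eq_zero]
    · have := coeff_forwardDelta_pow (P := P) (n := 0) (k := n) (by omega)
      rw [coeff_zero_eq_eval_zero] at this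
      simp [this, hf, hPc, hQc]
    · intro k hk
      obtain ⟨m, rfl⟩ := Nat.exists_eq_add_of_lt (Finset.mem_range.1 hk)
      rw [coeff_smul, coeff_eq_zero_of_natDegree_lt, smul_zero]
      refine Nat.lt_succ_of_le ((natDegree_forwardDelta_pow_le (n := k) ?_).trans (Nat.le_add_right k m))
      omega
-- From half-planes to strips
theorem rootStrip_subset_verticalStrip {P : ℂ[X]} {a b : EReal} (hab : a ≤ b)
    (h : ∀ z, P.eval z = 0 → z ∈ verticalStrip a b) : rootStrip P ⊆ verticalStrip a b :=
  Set.sInter_subset_of_mem ⟨a, b, hab, rfl, h⟩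

theorem rootStrip_eq_empty {P : ℂ[X]} (h : ∀ z, P.eval z ≠ 0) : rootStrip P = ∅ :=
  Set.eq_empty_of_subset_empty fun z hz => by
    simpa [verticalStrip] using
      rootStrip_subset_verticalStrip (le_refl ⊤) (fun z hz => (h z hz).elim) hz

theorem mem_verticalStrip_coe {a b : ℝ} {z : ℂ} :
    z ∈ verticalStrip a b ↔ a ≤ z.re ∧ z.re ≤ b := by
  simp [verticalStrip]

theorem verticalStrip_subset_rootStrip {P : ℂ[X]} {γ δ : ℂ} (hγ : P.eval γ = 0)
    (hδ : P.eval δ = 0) : verticalStrip γ.re δ.re ⊆ rootStrip P := by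
  rintro z ⟨h1, h2⟩ S ⟨a, b, -, rfl, hS⟩
  exact ⟨(hS γ hγ).1.trans h1, h2.trans (hS δ hδ).2⟩

theorem exists_extremal_roots {P : ℂ[X]} (hP : P ≠ 0) (h : ∃ z, P.eval z = 0) :
    ∃ γ δ, P.eval γ = 0 ∧ P.eval δ = 0 ∧ ∀ z, P.eval z = 0 → γ.re ≤ z.re ∧ z.re ≤ δ.re := by
  obtain ⟨w, hw⟩ := h
  have hne : P.roots.toFinset.Nonempty := ⟨w, by simp [hP, hw]⟩
  obtain ⟨γ, hγ, hγ2⟩ := P.roots.toFinset.exists_min_image Complex.re hne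
  obtain ⟨δ, hδ, hδ2⟩ := P.roots.toFinset.exists_max_image Complex.re hne
  have hmem : ∀ z, z ∈ P.roots.toFinset ↔ P.eval z = 0 := fun z => by simp [hP]
  simp only [hmem] at hγ hδ hγ2 hδ2
  exact ⟨γ, δ, hγ, hδ, fun z hz => ⟨hγ2 z hz, hδ2 z hz⟩⟩

theorem verticalStrip_subset_add_sub {a b c d : ℝ} (hab : a ≤ b) (hcd : c ≤ d) (t : ℝ) :
    verticalStrip (a + c - t : ℝ) (b + d - t : ℝ) ⊆
      verticalStrip a b + verticalStrip c d - {(t : ℂ)} := by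
  intro z hz
  rw [mem_verticalStrip_coe] at hz
  -- The least real part `u ≥ a` for which the complementary summand stays left of `d`.
  set u : ℝ := max a (z.re + t - d) with hu
  refine Set.mem_sub.2 ⟨z + t, Set.mem_add.2 ⟨u, ?_, z + t - u, ?_, by ring⟩, t, rfl, by ring⟩
  · rw [mem_verticalStrip_coe, Complex.ofReal_re]
    exact ⟨le_max_left _ _, max_le hab (by linarith [hz.2])⟩
  · rw [mem_verticalStrip_coe]
    have h1 : z.re + t - d ≤ u := le_max_right _ _
    have h2 : u ≤ z.re + t - c := max_le (by linarith [hz.1]) (by linarith)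
    simp only [Complex.sub_re, Complex.add_re, Complex.ofReal_re]
    constructor <;> linarith

/-- A root of the convolution forces its factors to have roots. -/
theorem exists_root_of_umbralConv_root {n : ℕ} {P Q : ℂ[X]} (hP : P.natDegree ≤ n)
    (hQ : Q.natDegree ≤ n) (hne : umbralConv forwardDelta n P Q ≠ 0) {z : ℂ}
    (hz : (umbralConv forwardDelta n P Q).eval z = 0) :
    (∃ γ, P.eval γ = 0) ∧ ∃ γ, Q.eval γ = 0 := by
  have hP0 : P ≠ 0 := by rintro rfl; simp [umbralConv] at hne
  have hQ0 : Q ≠ 0 := by rintro rfl; simp [umbralConv] at hne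
  have hbound : ∀ R : ℂ[X], R ≠ 0 → ∃ b : ℝ, ∀ γ, R.eval γ = 0 → 1 * γ.re ≤ b := fun R hR => by
    by_cases h : ∃ γ, R.eval γ = 0
    · obtain ⟨_, δ, _, _, hδ⟩ := exists_extremal_roots hR h
      exact ⟨δ.re, fun γ hγ => by linarith [(hδ γ hγ).2]⟩
    · exact ⟨0, fun γ hγ => (h ⟨γ, hγ⟩).elim⟩
  obtain ⟨b, hb⟩ := hbound P hP0
  obtain ⟨d, hd⟩ := hbound Q hQ0
  constructor
  · by_contra hcon
    -- Without roots of `P` every `b` is a valid bound, so `b` is chosen low enough to exclude the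
    -- root `z`.
    exact umbralConv_eval_ne_zero_of_ne_zero (.inl rfl) (b := z.re + (n - 1) / 2 - d - 1) hP hQ hne
      (fun γ hγ => (hcon ⟨γ, hγ⟩).elim) hd (by linarith) hz
  · by_contra hcon
    exact umbralConv_eval_ne_zero_of_ne_zero (.inl rfl) (d := z.re + (n - 1) / 2 - b - 1) hP hQ hne
      hb (fun γ hγ => (hcon ⟨γ, hγ⟩).elim) (by linarith) hz

theorem umbralConv_root_mem_verticalStrip {n : ℕ} {P Q : ℂ[X]} (hP : P.natDegree ≤ n)
    (hQ : Q.natDegree ≤ n) (hne : umbralConv forwardDelta n P Q ≠ 0) {a b c d : ℝ}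
    (hPr : ∀ γ, P.eval γ = 0 → a ≤ γ.re ∧ γ.re ≤ b)
    (hQr : ∀ γ, Q.eval γ = 0 → c ≤ γ.re ∧ γ.re ≤ d) {z : ℂ}
    (hz : (umbralConv forwardDelta n P Q).eval z = 0) :
    z ∈ verticalStrip (a + c - ((n : ℝ) - 1) / 2 : ℝ) (b + d - ((n : ℝ) - 1) / 2 : ℝ) := by
  rw [mem_verticalStrip_coe]
  constructor
  · by_contra! hlt
    exact umbralConv_eval_ne_zero_of_ne_zero (.inr rfl) (b := -a) (d := -c) hP hQ hne
      (fun γ hγ => by linarith [(hPr γ hγ).1]) (fun γ hγ => by linarith [(hQr γ hγ).1])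
      (by linarith) hz
  · by_contra! hlt
    exact umbralConv_eval_ne_zero_of_ne_zero (.inl rfl) (b := b) (d := d) hP hQ hne
      (fun γ hγ => by linarith [(hPr γ hγ).2]) (fun γ hγ => by linarith [(hQr γ hγ).2])
      (by linarith) hz

theorem rootStrip_umbralConv_subset {n : ℕ} {P Q : ℂ[X]} (hP : P.natDegree ≤ n)
    (hQ : Q.natDegree ≤ n) (hne : umbralConv forwardDelta n P Q ≠ 0) :
    rootStrip (umbralConv forwardDelta n P Q) ⊆
      rootStrip P + rootStrip Q - {((n : ℂ) - 1) / 2} := by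
  by_cases h : ∃ z, (umbralConv forwardDelta n P Q).eval z = 0
  swap
  · rw [rootStrip_eq_empty (not_exists.1 h)]
    exact Set.empty_subset _
  obtain ⟨z, hz⟩ := h
  have hP0 : P ≠ 0 := by rintro rfl; simp [umbralConv] at hne
  have hQ0 : Q ≠ 0 := by rintro rfl; simp [umbralConv] at hne
  obtain ⟨hPe, hQe⟩ := exists_root_of_umbralConv_root hP hQ hne hz
  obtain ⟨γ, δ, hγ, hδ, hPr⟩ := exists_extremal_roots hP0 hPe
  obtain ⟨γ', δ', hγ', hδ', hQr⟩ := exists_extremal_roots hQ0 hQe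
  have h1 := (hPr γ hγ).2
  have h2 := (hQr γ' hγ').2
  have ht : ((n : ℂ) - 1) / 2 = ((((n : ℝ) - 1) / 2 : ℝ) : ℂ) := by push_cast; ring
  rw [ht]
  exact (rootStrip_subset_verticalStrip (EReal.coe_le_coe_iff.2 (by linarith)) fun w hw =>
    umbralConv_root_mem_verticalStrip hP hQ hne hPr hQr hw).trans
      ((verticalStrip_subset_add_sub h1 h2 _).trans (Set.sub_subset_sub_right
        (Set.add_subset_add (verticalStrip_subset_rootStrip hγ hδ)
          (verticalStrip_subset_rootStrip hγ' hδ'))))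

theorem rootStrip_eq_of_roots_re {P : ℂ[X]} {c : ℝ} (hex : ∃ z, P.eval z = 0)
    (h : ∀ z, P.eval z = 0 → z.re = c) : rootStrip P = {z | z.re = c} := by
  obtain ⟨w, hw⟩ := hex
  have hset : {z : ℂ | z.re = c} = verticalStrip c c := by
    ext z
    rw [mem_verticalStrip_coe, Set.mem_ofPred_eq, le_antisymm_iff, and_comm]
  rw [hset]
  refine Set.Subset.antisymm (rootStrip_subset_verticalStrip le_rfl fun z hz => ?_) ?_
  · rw [← hset]
    exact h z hz
  · have := verticalStrip_subset_rootStrip hw hw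
    rwa [h w hw] at this

theorem rootStrip_X_pow {n : ℕ} (hn : 1 ≤ n) : rootStrip (X ^ n) = {z | z.re = 0} := by
  have hn0 : n ≠ 0 := by omega
  refine rootStrip_eq_of_roots_re ⟨0, by simp [hn0]⟩ fun z hz => ?_
  rw [eval_pow, eval_X] at hz
  simp [eq_zero_of_pow_eq_zero hz]

/-- Here the lower and upper bounds of the inclusion agree, and `n ≥ 1` guarantees a root. -/
theorem rootStrip_umbralConv_X_pow {n : ℕ} (hn : 1 ≤ n) :
    rootStrip (umbralConv forwardDelta n (X ^ n) (X ^ n)) = {z | z.re = -(((n : ℝ) - 1) / 2)} := by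
  have hdeg := degree_umbralConv (degree_X_pow (R := ℂ) n) (degree_X_pow n)
  have hne : umbralConv forwardDelta n (X ^ n) (X ^ n) ≠ 0 := by
    intro h0
    simp [h0] at hdeg
  have hr : ∀ γ : ℂ, (X ^ n : ℂ[X]).eval γ = 0 → 0 ≤ γ.re ∧ γ.re ≤ 0 := fun γ hγ => by
    rw [eval_pow, eval_X] at hγ
    simp [eq_zero_of_pow_eq_zero hγ]
  refine rootStrip_eq_of_roots_re (Complex.exists_root (by rw [hdeg]; exact_mod_cast hn))
    fun z hz => ?_
  have := mem_verticalStrip_coe.1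
    (umbralConv_root_mem_verticalStrip (natDegree_X_pow_le n) (natDegree_X_pow_le n) hne hr hr hz)
  linarith [this.1, this.2]

theorem setOf_re_eq_zero_add_sub (c : ℝ) :
    {z : ℂ | z.re = 0} + {z : ℂ | z.re = 0} - {(c : ℂ)} = {z : ℂ | z.re = -c} := by
  ext z
  constructor
  · rintro ⟨_, ⟨u, hu, v, hv, rfl⟩, _, rfl, rfl⟩
    rw [Set.mem_ofPred_eq] at hu hv ⊢
    simp [hu, hv]
  · intro hz
    rw [Set.mem_ofPred_eq] at hz
    refine Set.mem_sub.2 ⟨z + c, Set.mem_add.2 ⟨0, by simp, z + c, by simp [hz], by ring⟩, c, rfl,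
      by ring⟩

theorem mainTheorem2 :
    (∀ (n : ℕ) (P Q : ℂ[X]), P.natDegree ≤ n → Q.natDegree ≤ n →
      umbralConv forwardDelta n P Q ≠ 0 →
      rootStrip (umbralConv forwardDelta n P Q) ⊆
        rootStrip P + rootStrip Q - {((n : ℂ) - 1) / 2}) ∧
    (∀ (n : ℕ) (P Q : ℂ[X]), P.degree = n → Q.degree = n →
      (umbralConv forwardDelta n P Q).degree = n) ∧
    (∀ n : ℕ, 1 ≤ n →
      rootStrip (umbralConv forwardDelta n (X ^ n) (X ^ n)) =
        rootStrip (X ^ n) + rootStrip (X ^ n) - {((n : ℂ) - 1) / 2}) ∧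
    (∀ n : ℕ, 1 ≤ n → ∀ c : ℝ,
      (∀ P Q : ℂ[X], P.degree = n → Q.degree = n →
        rootStrip (umbralConv forwardDelta n P Q) ⊆
          rootStrip P + rootStrip Q - {(c : ℂ)}) →
      c = ((n : ℝ) - 1) / 2) := by
  refine ⟨fun n P Q hP hQ hne => rootStrip_umbralConv_subset hP hQ hne,
    fun n P Q hP hQ => degree_umbralConv hP hQ, fun n hn => ?_, fun n hn c h => ?_⟩
  · have ht : ((n : ℂ) - 1) / 2 = ((((n : ℝ) - 1) / 2 : ℝ) : ℂ) := by push_cast; ring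
    rw [rootStrip_umbralConv_X_pow hn, rootStrip_X_pow hn, ht, setOf_re_eq_zero_add_sub]
  · have hsub := h (X ^ n) (X ^ n) (degree_X_pow n) (degree_X_pow n)
    rw [rootStrip_umbralConv_X_pow hn, rootStrip_X_pow hn, setOf_re_eq_zero_add_sub] at hsub
    -- An inclusion of one vertical line in another is tested at its real point.
    have hmem := hsub (show ((-(((n : ℝ) - 1) / 2) : ℝ) : ℂ) ∈ _ from Complex.ofReal_re _)
    rw [Set.mem_ofPred_eq, Complex.ofReal_re] at hmem
    linarith
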